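/- Let $H$ be a complex separable Hilbert space of dimension at least $2$ (for instance infinite-dimensional) and let $p$ be a real number with $1 \le p < \infty$, $p \ne 2$. Let $S_p$ be the Schatten class of compact operators $A$ on $H$ whose singular values $\sigma_i(A)$ (the square roots of the nonzero eigenvalues of $A^*A$, counted with multiplicity) satisfy $\sum_i \sigma_i(A)^p < \infty$, with the norm $\|A\|_{S_p} = \left(\sum_i \sigma_i(A)^p\right)^{1/p}$, and let $L_p = L_p((0,1),\mathbb{R})$ with Lebesgue measure. Then there exists a real linear subspace of $S_p$, of real dimension $3$, which with the $S_p$-norm is not linearly isometric to any (real linear) subspace of $L_p$. In fact, the space of real symmetric $2 \times 2$ matrices is an example: for every orthonormal pair $e_1, e_2$ in $H$, the real vector space of the operators $x \mapsto \sum_{i,j=1}^{2} M_{ij} \langle e_j, x\rangle e_i$, where $\langle\cdot,\cdot\rangle$ is linear in its second argument and $M$ runs over the real symmetric $2 \times 2$ matrices, is contained in $S_p$, has real dimension $3$, and with the $S_p$-norm is not linearly isometric to any subspace of $L_p$. -/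

import Mathlib

open MeasureTheory

noncomputable section

namespace Schatten

variable {H : Type*} [NormedAddCommGroup H] [InnerProductSpace ℂ H] [CompleteSpace H]

/-- The multiplicity of `s > 0` as a singular value of `A`: the dimension of the eigenspace of
`A* A` for the eigenvalue `s ^ 2`. For compact `A` and `s > 0` this eigenspace is
finite-dimensional. -/
def singularMultiplicity (A : H →L[ℂ] H) (s : ℝ) : ℕ :=
  Module.finrank ℂ (Module.End.eigenspace
    ((ContinuousLinearMap.adjoint A ∘L A : H →L[ℂ] H) : H →ₗ[ℂ] H) ((s ^ 2 : ℝ) : ℂ))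

/-- The sum `∑ σᵢ(A) ^ p` over the (nonzero) singular values of `A`, counted with multiplicity, as
an element of `[0, ∞]`. -/
def powerSum (p : ℝ) (A : H →L[ℂ] H) : ENNReal :=
  ∑' s : Set.Ioi (0 : ℝ), (singularMultiplicity A s : ENNReal) * ENNReal.ofReal ((s : ℝ) ^ p)

variable (H) in
/-- The Schatten class `S_p` on `H`: the compact operators whose singular values are
`p`-summable. -/
def schattenClass (p : ℝ) : Set (H →L[ℂ] H) :=
  {A | IsCompactOperator A ∧ powerSum p A < ⊤}

/-- The Schatten norm `(∑ σᵢ(A) ^ p) ^ (1 / p)`. -/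
def schattenNorm (p : ℝ) (A : H →L[ℂ] H) : ℝ :=
  (powerSum p A).toReal ^ (1 / p)

/-- The real Lebesgue space `L_p = L_p((0, 1), ℝ)`. -/
abbrev RealLp (p : ℝ) :=
  Lp ℝ (ENNReal.ofReal p) (volume.restrict (Set.Ioo (0 : ℝ) 1))

/-- The real vector space `V` of operators, with the Schatten `p`-norm, is linearly isometric to a
subspace of the real space `L_p`. -/
def IsometricToSubspaceOfLp (p : ℝ) (V : Submodule ℝ (H →L[ℂ] H)) : Prop :=
  ∃ (W : Submodule ℝ (RealLp p)) (T : V ≃ₗ[ℝ] W),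
    ∀ A : V, ‖(T A : RealLp p)‖ = schattenNorm p (A : H →L[ℂ] H)

/-- The operator `∑ i j, M i j • e i ⊗ (e j)*` on `H`. If `e` is orthonormal, it has matrix `M` with
respect to `e` on the span of `e`, and vanishes on the orthogonal complement of that span. -/
def ofMatrix (e : Fin 2 → H) (M : Matrix (Fin 2) (Fin 2) ℝ) : H →L[ℂ] H :=
  ∑ i, ∑ j, (M i j : ℝ) • InnerProductSpace.rankOne ℂ (e i) (e j)

/-- The real vector space of the operators on `H` given by real symmetric `2 × 2` matrices with
respect to `e`. -/
def symmetricMatrices (e : Fin 2 → H) : Submodule ℝ (H →L[ℂ] H) where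
  carrier := {A | ∃ M : Matrix (Fin 2) (Fin 2) ℝ, M.IsSymm ∧ A = ofMatrix e M}
  add_mem' := by
    rintro _ _ ⟨M, hM, rfl⟩ ⟨N, hN, rfl⟩
    exact ⟨M + N, hM.add hN, by simp [ofMatrix, add_smul]; abel⟩
  zero_mem' := ⟨0, Matrix.isSymm_zero, by simp [ofMatrix]⟩
  smul_mem' := by
    rintro c _ ⟨M, hM, rfl⟩
    exact ⟨c • M, hM.smul c, by simp [ofMatrix, mul_smul, smul_add]⟩

end Schatten

end

/-!
Equality in Clarkson's inequality, for the `L_p` norm with `p ≠ 2`, forces two functions to have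
disjoint supports almost everywhere. A reflection `R = P - Q` of the plane, with `P` and `Q` its
spectral projections, satisfies this equality: `‖P‖ ^ p = ‖Q‖ ^ p = 1` and
`‖P + Q‖ ^ p = ‖P - Q‖ ^ p = 2`. Hence under an isometry into `L_p` every reflection is sent to
`± h` pointwise, where `h` is the image of the identity. But three reflections in lines at angles of
60 degrees add up to zero, and three terms `± h x` can only do so when `h x = 0`. So the identity is
sent to zero, which is absurd.
-/

open scoped InnerProductSpace Real

namespace Schatten

section Clarkson

lemma rpow_eq_mul_rpow_sub_one {q x : ℝ} (hx : 0 < x) : x ^ q = x * x ^ (q - 1) := by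
  rw [Real.rpow_sub_one hx.ne', mul_div_cancel₀ _ hx.ne']

lemma add_rpow_lt_rpow_add {q x y : ℝ} (hq : 1 < q) (hx : 0 < x) (hy : 0 < y) :
    x ^ q + y ^ q < (x + y) ^ q := by
  have hlt {z : ℝ} (hz : 0 < z) (hzs : z < x + y) : z ^ (q - 1) < (x + y) ^ (q - 1) :=
    Real.rpow_lt_rpow hz.le hzs (sub_pos.2 hq)
  rw [rpow_eq_mul_rpow_sub_one hx, rpow_eq_mul_rpow_sub_one hy,
    rpow_eq_mul_rpow_sub_one (add_pos hx hy), add_mul]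
  exact add_lt_add (mul_lt_mul_of_pos_left (hlt hx (lt_add_of_pos_right x hy)) hx)
    (mul_lt_mul_of_pos_left (hlt hy (lt_add_of_pos_left y hx)) hy)

lemma rpow_add_lt_add_rpow {q x y : ℝ} (hq : q < 1) (hx : 0 < x) (hy : 0 < y) :
    (x + y) ^ q < x ^ q + y ^ q := by
  have hlt {z : ℝ} (hz : 0 < z) (hzs : z < x + y) : (x + y) ^ (q - 1) < z ^ (q - 1) :=
    Real.rpow_lt_rpow_of_neg hz hzs (sub_neg.2 hq)
  rw [rpow_eq_mul_rpow_sub_one hx, rpow_eq_mul_rpow_sub_one hy,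
    rpow_eq_mul_rpow_sub_one (add_pos hx hy), add_mul]
  exact add_lt_add (mul_lt_mul_of_pos_left (hlt hx (lt_add_of_pos_right x hy)) hx)
    (mul_lt_mul_of_pos_left (hlt hy (lt_add_of_pos_left y hx)) hy)

variable {E : Type*} [NormedAddCommGroup E]

lemma norm_rpow_eq_sq_rpow (p : ℝ) (u : E) : ‖u‖ ^ p = (‖u‖ ^ 2) ^ (p / 2) := by
  rw [← Real.rpow_natCast_mul (norm_nonneg u), Nat.cast_ofNat, mul_div_cancel₀ _ two_ne_zero]

variable [InnerProductSpace ℝ E]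

lemma midpoint_norm_add_sq_norm_sub_sq (u v : E) :
    1 / 2 * ‖u + v‖ ^ 2 + 1 / 2 * ‖u - v‖ ^ 2 = ‖u‖ ^ 2 + ‖v‖ ^ 2 := by
  linarith [parallelogram_law_with_norm ℝ u v]

lemma two_mul_sq_add_sq_rpow_le {p : ℝ} (hp : 2 ≤ p) (u v : E) :
    2 * (‖u‖ ^ 2 + ‖v‖ ^ 2) ^ (p / 2) ≤ ‖u + v‖ ^ p + ‖u - v‖ ^ p := by
  have h := (convexOn_rpow (p := p / 2) (by linarith)).2 (sq_nonneg ‖u + v‖) (sq_nonneg ‖u - v‖)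
    one_half_pos.le one_half_pos.le (add_halves 1)
  simp only [smul_eq_mul, midpoint_norm_add_sq_norm_sub_sq, ← norm_rpow_eq_sq_rpow] at h
  linarith

lemma le_two_mul_sq_add_sq_rpow {p : ℝ} (hp : 0 ≤ p) (hp2 : p ≤ 2) (u v : E) :
    ‖u + v‖ ^ p + ‖u - v‖ ^ p ≤ 2 * (‖u‖ ^ 2 + ‖v‖ ^ 2) ^ (p / 2) := by
  have h := (Real.concaveOn_rpow (p := p / 2) (by linarith) (by linarith)).2
    (sq_nonneg ‖u + v‖) (sq_nonneg ‖u - v‖) one_half_pos.le one_half_pos.le (add_halves 1)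
  simp only [smul_eq_mul, midpoint_norm_add_sq_norm_sub_sq, ← norm_rpow_eq_sq_rpow] at h
  linarith

lemma clarkson_of_two_le {p : ℝ} (hp : 2 ≤ p) (u v : E) :
    2 * (‖u‖ ^ p + ‖v‖ ^ p) ≤ ‖u + v‖ ^ p + ‖u - v‖ ^ p := by
  refine le_trans ?_ (two_mul_sq_add_sq_rpow_le hp u v)
  rw [norm_rpow_eq_sq_rpow p u, norm_rpow_eq_sq_rpow p v]
  gcongr
  exact Real.add_rpow_le_rpow_add (by positivity) (by positivity) (by linarith)

lemma clarkson_of_le_two {p : ℝ} (hp : 0 ≤ p) (hp2 : p ≤ 2) (u v : E) :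
    ‖u + v‖ ^ p + ‖u - v‖ ^ p ≤ 2 * (‖u‖ ^ p + ‖v‖ ^ p) := by
  refine (le_two_mul_sq_add_sq_rpow hp hp2 u v).trans ?_
  rw [norm_rpow_eq_sq_rpow p u, norm_rpow_eq_sq_rpow p v]
  gcongr
  exact Real.rpow_add_le_add_rpow (by positivity) (by positivity) (by linarith) (by linarith)

lemma eq_zero_or_eq_zero_of_clarkson_eq {p : ℝ} (hp : 0 ≤ p) (hp2 : p ≠ 2) {u v : E}
    (h : ‖u + v‖ ^ p + ‖u - v‖ ^ p = 2 * (‖u‖ ^ p + ‖v‖ ^ p)) : u = 0 ∨ v = 0 := by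
  by_contra! huv
  have hu : 0 < ‖u‖ ^ 2 := pow_pos (norm_pos_iff.2 huv.1) 2
  have hv : 0 < ‖v‖ ^ 2 := pow_pos (norm_pos_iff.2 huv.2) 2
  rw [norm_rpow_eq_sq_rpow p u, norm_rpow_eq_sq_rpow p v] at h
  rcases hp2.lt_or_gt with hlt | hgt
  · linarith [le_two_mul_sq_add_sq_rpow hp hlt.le u v,
      rpow_add_lt_add_rpow (q := p / 2) (by linarith) hu hv]
  · linarith [two_mul_sq_add_sq_rpow_le hgt.le u v,
      add_rpow_lt_rpow_add (q := p / 2) (by linarith) hu hv]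

end Clarkson

section Lp

variable {α E : Type*} [MeasurableSpace α] {μ : Measure α} [NormedAddCommGroup E] {p : ℝ}

lemma integrable_norm_rpow_of_memLp (hp : 0 < p) {f : α → E} (hf : MemLp f (ENNReal.ofReal p) μ) :
    Integrable (fun x => ‖f x‖ ^ p) μ := by
  simpa only [ENNReal.toReal_ofReal hp.le] using
    hf.integrable_norm_rpow (by simpa using hp) ENNReal.ofReal_ne_top

lemma norm_rpow_eq_integral (hp : 0 < p) (f : Lp E (ENNReal.ofReal p) μ) :
    ‖f‖ ^ p = ∫ x, ‖f x‖ ^ p ∂μ := by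
  have hnonneg : 0 ≤ ∫ x, ‖f x‖ ^ p ∂μ := integral_nonneg fun x => by positivity
  rw [Lp.norm_def, (Lp.memLp f).eLpNorm_eq_integral_rpow_norm (by simpa using hp)
    ENNReal.ofReal_ne_top, ENNReal.toReal_ofReal hp.le, ENNReal.toReal_ofReal (by positivity),
    Real.rpow_inv_rpow hnonneg hp.ne']

variable [InnerProductSpace ℝ E]

lemma ae_eq_zero_or_eq_zero_of_clarkson_eq (hp : 0 < p) (hp2 : p ≠ 2)
    {u v : Lp E (ENNReal.ofReal p) μ}
    (h : ‖u + v‖ ^ p + ‖u - v‖ ^ p = 2 * (‖u‖ ^ p + ‖v‖ ^ p)) :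
    ∀ᵐ x ∂μ, u x = 0 ∨ v x = 0 := by
  have hadd : ‖u + v‖ ^ p = ∫ x, ‖u x + v x‖ ^ p ∂μ := by
    rw [norm_rpow_eq_integral hp]
    exact integral_congr_ae ((Lp.coeFn_add u v).fun_comp (‖·‖ ^ p))
  have hsub : ‖u - v‖ ^ p = ∫ x, ‖u x - v x‖ ^ p ∂μ := by
    rw [norm_rpow_eq_integral hp]
    exact integral_congr_ae ((Lp.coeFn_sub u v).fun_comp (‖·‖ ^ p))
  have hu := integrable_norm_rpow_of_memLp hp (Lp.memLp u)
  have hv := integrable_norm_rpow_of_memLp hp (Lp.memLp v)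
  have hu_add_v : Integrable (fun x => ‖u x + v x‖ ^ p) μ :=
    integrable_norm_rpow_of_memLp hp ((Lp.memLp u).add (Lp.memLp v))
  have hu_sub_v : Integrable (fun x => ‖u x - v x‖ ^ p) μ :=
    integrable_norm_rpow_of_memLp hp ((Lp.memLp u).sub (Lp.memLp v))
  rw [hadd, hsub, norm_rpow_eq_integral hp, norm_rpow_eq_integral hp,
    ← integral_add hu_add_v hu_sub_v, ← integral_add hu hv, ← integral_const_mul] at h
  have heq : (fun x => ‖u x + v x‖ ^ p + ‖u x - v x‖ ^ p) =ᵐ[μ]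
      fun x => 2 * (‖u x‖ ^ p + ‖v x‖ ^ p) := by
    rcases hp2.lt_or_gt with hlt | hgt
    · exact (integral_eq_iff_of_ae_le (hu_add_v.add hu_sub_v) ((hu.add hv).const_mul 2)
        (.of_forall fun x => clarkson_of_le_two hp.le hlt.le (u x) (v x))).1 h
    · exact ((integral_eq_iff_of_ae_le ((hu.add hv).const_mul 2) (hu_add_v.add hu_sub_v)
        (.of_forall fun x => clarkson_of_two_le hgt.le (u x) (v x))).1 h.symm).symm
  exact heq.mono fun x hx => eq_zero_or_eq_zero_of_clarkson_eq hp.le hp2 hx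

variable {F : ℝ × ℝ × ℝ →ₗ[ℝ] Lp E (ENNReal.ofReal p) μ}

lemma ae_eq_or_eq_neg_of_norm_polar_rpow_eq (hp : 0 < p) (hp2 : p ≠ 2)
    (hF : ∀ a r θ : ℝ, ‖F (a, r * Real.cos θ, r * Real.sin θ)‖ ^ p = |a + r| ^ p + |a - r| ^ p)
    (θ : ℝ) :
    ∀ᵐ x ∂μ, F (0, Real.cos θ, Real.sin θ) x = F (1, 0, 0) x ∨
      F (0, Real.cos θ, Real.sin θ) x = -F (1, 0, 0) x := by
  -- The images of the spectral projections of the reflection `(0, cos θ, sin θ)`.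
  let u := F (1 / 2, 1 / 2 * Real.cos θ, 1 / 2 * Real.sin θ)
  let v := F (1 / 2, -1 / 2 * Real.cos θ, -1 / 2 * Real.sin θ)
  have hadd : u + v = F (1, 0, 0) := by
    simp only [u, v, ← map_add, Prod.mk_add_mk]
    ring_nf
  have hsub : u - v = F (0, Real.cos θ, Real.sin θ) := by
    simp only [u, v, ← map_sub, Prod.mk_sub_mk]
    ring_nf
  have hu : ‖u‖ ^ p = 1 := by
    rw [hF]
    norm_num [Real.zero_rpow hp.ne']
  have hv : ‖v‖ ^ p = 1 := by
    rw [hF]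
    norm_num [Real.zero_rpow hp.ne']
  have hu_add_v : ‖u + v‖ ^ p = 2 := by
    simpa [hadd, one_add_one_eq_two] using hF 1 0 0
  have hu_sub_v : ‖u - v‖ ^ p = 2 := by
    simpa [hsub, one_add_one_eq_two] using hF 0 1 θ
  have hdisj := ae_eq_zero_or_eq_zero_of_clarkson_eq hp hp2 (u := u) (v := v)
    (by rw [hu, hv, hu_add_v, hu_sub_v]; norm_num)
  rw [← hadd, ← hsub]
  filter_upwards [hdisj, Lp.coeFn_add u v, Lp.coeFn_sub u v] with x hx hadd hsub
  rw [hadd, hsub, Pi.add_apply, Pi.sub_apply]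
  rcases hx with hx | hx <;> simp [hx]

lemma eq_zero_of_add_add_eq_zero_of_eq_or_eq_neg {w x y z : E} (hsum : x + y + z = 0)
    (hx : x = w ∨ x = -w) (hy : y = w ∨ y = -w) (hz : z = w ∨ z = -w) : w = 0 := by
  have hthree (h : w + w + w = 0) : w = 0 :=
    (smul_eq_zero.1 (show (3 : ℝ) • w = 0 by rw [← h]; module)).resolve_left three_ne_zero
  have hthree_neg (h : -w + -w + -w = 0) : w = 0 :=
    hthree (by rw [← neg_eq_zero, ← h]; abel)
  rcases hx with rfl | rfl <;> rcases hy with rfl | rfl <;> rcases hz with rfl | rfl <;>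
    first | exact hthree hsum | exact hthree_neg hsum | simpa using hsum

lemma not_forall_norm_polar_rpow_eq (hp : 0 < p) (hp2 : p ≠ 2) :
    ¬ ∀ a r θ : ℝ,
      ‖F (a, r * Real.cos θ, r * Real.sin θ)‖ ^ p = |a + r| ^ p + |a - r| ^ p := by
  intro hF
  let R (θ : ℝ) := F (0, Real.cos θ, Real.sin θ)
  have hsum : R 0 + R (2 * π / 3) + R (-(2 * π / 3)) = 0 := by
    have hcos : Real.cos (2 * π / 3) = -1 / 2 := by
      rw [show 2 * π / 3 = π - π / 3 by ring, Real.cos_pi_sub, Real.cos_pi_div_three]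
      norm_num
    simp only [R, ← map_add, Prod.mk_add_mk, Real.cos_neg, Real.sin_neg, hcos]
    refine (congrArg F ?_).trans (map_zero F)
    norm_num
  have hzero : F (1, 0, 0) = 0 := by
    rw [Lp.eq_zero_iff_ae_eq_zero]
    filter_upwards [ae_eq_or_eq_neg_of_norm_polar_rpow_eq hp hp2 hF 0,
      ae_eq_or_eq_neg_of_norm_polar_rpow_eq hp hp2 hF (2 * π / 3),
      ae_eq_or_eq_neg_of_norm_polar_rpow_eq hp hp2 hF (-(2 * π / 3)),
      Lp.coeFn_add (R 0 + R (2 * π / 3)) (R (-(2 * π / 3))), Lp.coeFn_add (R 0) (R (2 * π / 3)),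
      (Lp.eq_zero_iff_ae_eq_zero).1 hsum] with x h0 h1 h2 hadd hadd' hsum
    rw [hadd, Pi.add_apply, hadd'] at hsum
    exact eq_zero_of_add_add_eq_zero_of_eq_or_eq_neg hsum h0 h1 h2
  have hnorm := hF 1 0 0
  norm_num [hzero, Real.zero_rpow hp.ne'] at hnorm

end Lp

section DiagonalOp

variable {𝕜 H ι : Type*} [RCLike 𝕜] [NormedAddCommGroup H] [InnerProductSpace 𝕜 H] [Fintype ι]

/-- The operator `∑ i, d i • f i ⊗ (f i)*`. When `f` is orthonormal, it is diagonal with respect to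
`f`, with eigenvalues `d`, and vanishes on the orthogonal complement of the span of `f`. -/
noncomputable def diagonalOp (f : ι → H) (d : ι → 𝕜) : H →L[𝕜] H :=
  ∑ i, d i • InnerProductSpace.rankOne 𝕜 (f i) (f i)

variable {f : ι → H}

lemma diagonalOp_apply (f : ι → H) (d : ι → 𝕜) (x : H) :
    diagonalOp f d x = ∑ i, (d i * ⟪f i, x⟫_𝕜) • f i := by
  simp [diagonalOp, mul_smul]

lemma isCompactOperator_rankOne (x y : H) :
    IsCompactOperator (InnerProductSpace.rankOne 𝕜 x y) :=
  (isCompactOperator_of_locallyCompactSpace_dom (innerSL 𝕜 y)).clm_comp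
    (ContinuousLinearMap.toSpanSingleton 𝕜 x)

lemma isCompactOperator_diagonalOp (f : ι → H) (d : ι → 𝕜) :
    IsCompactOperator (diagonalOp f d) :=
  Submodule.sum_mem (compactOperator (RingHom.id 𝕜) H H) fun i _ =>
    Submodule.smul_mem _ (d i) (isCompactOperator_rankOne (f i) (f i))

lemma adjoint_diagonalOp [CompleteSpace H] (f : ι → H) (d : ι → 𝕜) :
    ContinuousLinearMap.adjoint (diagonalOp f d) = diagonalOp f (star d) := by
  simp only [diagonalOp, map_sum, map_smulₛₗ, InnerProductSpace.adjoint_rankOne, Pi.star_apply,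
    RCLike.star_def]

lemma inner_diagonalOp_apply (hf : Orthonormal 𝕜 f) (d : ι → 𝕜) (i : ι) (x : H) :
    ⟪f i, diagonalOp f d x⟫_𝕜 = d i * ⟪f i, x⟫_𝕜 := by
  rw [diagonalOp_apply, hf.inner_right_fintype]

lemma diagonalOp_apply_self (hf : Orthonormal 𝕜 f) (d : ι → 𝕜) (i : ι) :
    diagonalOp f d (f i) = d i • f i := by
  classical
  simp [diagonalOp_apply, orthonormal_iff_ite.1 hf]

lemma diagonalOp_comp_diagonalOp (hf : Orthonormal 𝕜 f) (c d : ι → 𝕜) :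
    diagonalOp f c ∘L diagonalOp f d = diagonalOp f (c * d) := by
  ext x
  simp only [ContinuousLinearMap.comp_apply, diagonalOp_apply f c, diagonalOp_apply f (c * d),
    inner_diagonalOp_apply hf, Pi.mul_apply, mul_assoc]

lemma eigenspace_diagonalOp (hf : Orthonormal 𝕜 f) (d : ι → 𝕜) {c : 𝕜} (hc : c ≠ 0) :
    Module.End.eigenspace (diagonalOp f d : H →ₗ[𝕜] H) c =
      Submodule.span 𝕜 (Set.range fun i : {i // d i = c} => f i) := by
  apply le_antisymm
  · intro x hx
    replace hx : diagonalOp f d x = c • x := Module.End.mem_eigenspace_iff.1 hx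
    have hcoeff (i : ι) (hi : d i ≠ c) : ⟪f i, x⟫_𝕜 = 0 := by
      have h := inner_diagonalOp_apply hf d i x
      rw [hx, inner_smul_right] at h
      exact (mul_eq_mul_right_iff.1 h).resolve_left hi.symm
    rw [← Submodule.smul_mem_iff _ hc, ← hx, diagonalOp_apply]
    refine Submodule.sum_mem _ fun i _ => ?_
    by_cases hi : d i = c
    · exact Submodule.smul_mem _ _ (Submodule.subset_span ⟨⟨i, hi⟩, rfl⟩)
    · simp [hcoeff i hi]
  · rw [Submodule.span_le]
    rintro _ ⟨⟨i, rfl⟩, rfl⟩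
    exact Module.End.mem_eigenspace_iff.2 (diagonalOp_apply_self hf d i)

end DiagonalOp

section SingularValues

variable {H ι : Type*} [NormedAddCommGroup H] [InnerProductSpace ℂ H] [CompleteSpace H]
  [Fintype ι] {f : ι → H}

lemma singularMultiplicity_diagonalOp (hf : Orthonormal ℂ f) (d : ι → ℂ) {s : ℝ} (hs : 0 < s) :
    singularMultiplicity (diagonalOp f d) s = Finset.card {i | ‖d i‖ = s} := by
  have heig (i : ι) : (star d * d) i = ((s ^ 2 : ℝ) : ℂ) ↔ ‖d i‖ = s := by
    rw [Pi.mul_apply, Pi.star_apply, RCLike.star_def, Complex.conj_mul', ← Complex.ofReal_pow,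
      Complex.ofReal_inj, sq_eq_sq₀ (norm_nonneg _) hs.le]
  rw [singularMultiplicity, adjoint_diagonalOp, diagonalOp_comp_diagonalOp hf,
    eigenspace_diagonalOp hf _ (by exact_mod_cast (pow_pos hs 2).ne'),
    finrank_span_eq_card (b := fun i : {i // (star d * d) i = _} => f i)
      (hf.linearIndependent.comp _ Subtype.val_injective), Fintype.card_subtype]
  simp only [heig]

lemma powerSum_diagonalOp (hf : Orthonormal ℂ f) (d : ι → ℂ) {p : ℝ} (hp : 0 < p) :
    powerSum p (diagonalOp f d) = ENNReal.ofReal (∑ i, ‖d i‖ ^ p) := by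
  have hterm (s : Set.Ioi (0 : ℝ)) :
      (singularMultiplicity (diagonalOp f d) s : ENNReal) * ENNReal.ofReal ((s : ℝ) ^ p) =
        ∑ i, if ‖d i‖ = s then ENNReal.ofReal (‖d i‖ ^ p) else 0 := by
    rw [singularMultiplicity_diagonalOp hf d s.2, ← Finset.sum_filter, ← nsmul_eq_mul]
    refine (Finset.sum_eq_card_nsmul fun i hi => ?_).symm
    rw [(Finset.mem_filter.1 hi).2]
  rw [powerSum, tsum_congr hterm, Summable.tsum_finsetSum fun _ _ => ENNReal.summable,
    ENNReal.ofReal_sum_of_nonneg fun i _ => by positivity]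
  refine Finset.sum_congr rfl fun i _ => ?_
  by_cases hi : d i = 0
  · simp [hi, Real.zero_rpow hp.ne']
  · rw [tsum_eq_single (⟨‖d i‖, norm_pos_iff.2 hi⟩ : Set.Ioi (0 : ℝ)), if_pos rfl]
    exact fun s hs => if_neg fun h => hs (Subtype.ext h.symm)

lemma diagonalOp_mem_schattenClass (hf : Orthonormal ℂ f) (d : ι → ℂ) {p : ℝ} (hp : 0 < p) :
    diagonalOp f d ∈ schattenClass H p :=
  ⟨isCompactOperator_diagonalOp f d, powerSum_diagonalOp hf d hp ▸ ENNReal.ofReal_lt_top⟩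

lemma schattenNorm_diagonalOp_rpow (hf : Orthonormal ℂ f) (d : ι → ℂ) {p : ℝ} (hp : 0 < p) :
    schattenNorm p (diagonalOp f d) ^ p = ∑ i, ‖d i‖ ^ p := by
  have hnonneg : 0 ≤ ∑ i, ‖d i‖ ^ p := Finset.sum_nonneg fun i _ => by positivity
  rw [schattenNorm, powerSum_diagonalOp hf d hp, ENNReal.toReal_ofReal hnonneg, one_div,
    Real.rpow_inv_rpow hnonneg hp.ne']

end SingularValues

section SymmetricMatrices

variable {H : Type*} [NormedAddCommGroup H] [InnerProductSpace ℂ H] {e : Fin 2 → H}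

lemma ofMatrix_fin_two (e : Fin 2 → H) (a b c d : ℝ) :
    ofMatrix e !![a, b; c, d] =
      a • InnerProductSpace.rankOne ℂ (e 0) (e 0) + b • InnerProductSpace.rankOne ℂ (e 0) (e 1) +
        (c • InnerProductSpace.rankOne ℂ (e 1) (e 0) +
          d • InnerProductSpace.rankOne ℂ (e 1) (e 1)) := by
  simp [ofMatrix]

/-- The operators given by real symmetric `2 × 2` matrices, in coordinates with respect to the
matrices `!![1, 0; 0, 1]`, `!![1, 0; 0, -1]` and `!![0, 1; 1, 0]`: in these coordinates the
eigenvalues of `(a, r cos θ, r sin θ)` are `a + r` and `a - r`. -/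
noncomputable def symmetricOp (e : Fin 2 → H) : ℝ × ℝ × ℝ →ₗ[ℝ] (H →L[ℂ] H) where
  toFun v := ofMatrix e !![v.1 + v.2.1, v.2.2; v.2.2, v.1 - v.2.1]
  map_add' v w := by
    simp only [ofMatrix_fin_two, Prod.fst_add, Prod.snd_add]
    module
  map_smul' c v := by
    simp only [ofMatrix_fin_two, Prod.smul_fst, Prod.smul_snd, smul_eq_mul, Real.ringHom_apply]
    module

/-- The pair obtained from `e` by rotation through the angle `φ`; for `φ = θ / 2` it diagonalizes
`symmetricOp e (a, r cos θ, r sin θ)`. -/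
noncomputable def rotate (e : Fin 2 → H) (φ : ℝ) : Fin 2 → H :=
  ![(Real.cos φ : ℂ) • e 0 + (Real.sin φ : ℂ) • e 1,
    -(Real.sin φ : ℂ) • e 0 + (Real.cos φ : ℂ) • e 1]

lemma orthonormal_rotate (he : Orthonormal ℂ e) (φ : ℝ) : Orthonormal ℂ (rotate e φ) := by
  have hone : (Real.cos φ : ℂ) ^ 2 + (Real.sin φ : ℂ) ^ 2 = 1 := by
    exact_mod_cast Real.cos_sq_add_sin_sq φ
  have he' := orthonormal_iff_ite.1 he
  rw [orthonormal_iff_ite]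
  intro i j
  fin_cases i <;> fin_cases j <;>
    simp only [rotate, Fin.zero_eta, Fin.mk_one, Matrix.cons_val_zero, Matrix.cons_val_one,
      inner_add_left, inner_add_right, inner_smul_left, inner_smul_right, he', map_neg,
      Complex.conj_ofReal, ↓reduceIte, zero_ne_one, one_ne_zero] <;>
    first | linear_combination hone | ring

lemma symmetricOp_polar (e : Fin 2 → H) (a r θ : ℝ) :
    symmetricOp e (a, r * Real.cos θ, r * Real.sin θ) =
      diagonalOp (rotate e (θ / 2)) ![((a + r : ℝ) : ℂ), ((a - r : ℝ) : ℂ)] := by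
  have hcos : Real.cos θ = Real.cos (θ / 2) ^ 2 - Real.sin (θ / 2) ^ 2 := by
    rw [← Real.cos_two_mul', mul_div_cancel₀ θ two_ne_zero]
  have hsin : Real.sin θ = 2 * Real.sin (θ / 2) * Real.cos (θ / 2) := by
    rw [← Real.sin_two_mul, mul_div_cancel₀ θ two_ne_zero]
  have hone : (Real.cos (θ / 2) : ℂ) ^ 2 + (Real.sin (θ / 2) : ℂ) ^ 2 = 1 := by
    exact_mod_cast Real.cos_sq_add_sin_sq (θ / 2)
  rw [rotate, hcos, hsin]
  generalize Real.cos (θ / 2) = C, Real.sin (θ / 2) = S at hone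
  ext x
  simp only [symmetricOp, LinearMap.coe_mk, AddHom.coe_mk, ofMatrix_fin_two, diagonalOp_apply,
    Fin.sum_univ_two, Matrix.cons_val_zero, Matrix.cons_val_one, _root_.add_apply,
    _root_.smul_apply, InnerProductSpace.rankOne_apply, inner_add_left, inner_smul_left, map_neg,
    ← Complex.coe_smul, Complex.conj_ofReal]
  push_cast
  match_scalars
  · linear_combination -(a : ℂ) * ⟪e 0, x⟫_ℂ * hone
  · linear_combination -(a : ℂ) * ⟪e 1, x⟫_ℂ * hone

lemma range_symmetricOp (e : Fin 2 → H) :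
    LinearMap.range (symmetricOp e) = symmetricMatrices e := by
  ext A
  constructor
  · rintro ⟨v, rfl⟩
    refine ⟨_, ?_, rfl⟩
    ext i j
    fin_cases i <;> fin_cases j <;> rfl
  · rintro ⟨M, hM, rfl⟩
    refine ⟨((M 0 0 + M 1 1) / 2, (M 0 0 - M 1 1) / 2, M 0 1), congrArg (ofMatrix e) ?_⟩
    ext i j
    fin_cases i <;> fin_cases j <;> simp [hM.apply] <;> ring

lemma inner_ofMatrix_apply (he : Orthonormal ℂ e) (M : Matrix (Fin 2) (Fin 2) ℝ) (i j : Fin 2) :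
    ⟪e i, ofMatrix e M (e j)⟫_ℂ = M i j := by
  simp only [ofMatrix, _root_.sum_apply, _root_.smul_apply, InnerProductSpace.rankOne_apply,
    ← Complex.coe_smul, inner_sum, inner_smul_right, orthonormal_iff_ite.1 he]
  simp

lemma symmetricOp_injective (he : Orthonormal ℂ e) : Function.Injective (symmetricOp e) := by
  rintro ⟨a, b, c⟩ ⟨a', b', c'⟩ h
  have hentry (i j : Fin 2) :
      !![a + b, c; c, a - b] i j = !![a' + b', c'; c', a' - b'] i j := by
    have := congrArg (fun A => ⟪e i, A (e j)⟫_ℂ) h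
    simp only [symmetricOp, LinearMap.coe_mk, AddHom.coe_mk, inner_ofMatrix_apply he] at this
    exact_mod_cast this
  have h00 : a + b = a' + b' := hentry 0 0
  have h01 : c = c' := hentry 0 1
  have h11 : a - b = a' - b' := hentry 1 1
  ext <;> dsimp only <;> linarith

lemma finrank_symmetricMatrices (he : Orthonormal ℂ e) :
    Module.finrank ℝ (symmetricMatrices e) = 3 := by
  rw [← range_symmetricOp, LinearMap.finrank_range_of_inj (symmetricOp_injective he)]
  simp

variable [CompleteSpace H] {p : ℝ}

lemma symmetricMatrices_subset_schattenClass (he : Orthonormal ℂ e) (hp : 0 < p) :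
    (symmetricMatrices e : Set (H →L[ℂ] H)) ⊆ schattenClass H p := by
  rw [← range_symmetricOp]
  rintro _ ⟨⟨a, b, c⟩, rfl⟩
  let z : ℂ := ⟨b, c⟩
  have hz : (a, b, c) = (a, ‖z‖ * Real.cos z.arg, ‖z‖ * Real.sin z.arg) := by
    rw [Complex.norm_mul_cos_arg, Complex.norm_mul_sin_arg]
  rw [hz, symmetricOp_polar]
  exact diagonalOp_mem_schattenClass (orthonormal_rotate he _) _ hp

lemma schattenNorm_symmetricOp_polar_rpow (he : Orthonormal ℂ e) (hp : 0 < p) (a r θ : ℝ) :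
    schattenNorm p (symmetricOp e (a, r * Real.cos θ, r * Real.sin θ)) ^ p =
      |a + r| ^ p + |a - r| ^ p := by
  rw [symmetricOp_polar, schattenNorm_diagonalOp_rpow (orthonormal_rotate he _) _ hp,
    Fin.sum_univ_two]
  simp only [Matrix.cons_val_zero, Matrix.cons_val_one, Complex.norm_real, Real.norm_eq_abs]

end SymmetricMatrices

section Embedding

lemma exists_orthonormal_fin {𝕜 E : Type*} [RCLike 𝕜] [NormedAddCommGroup E]
    [InnerProductSpace 𝕜 E] {n : ℕ} (hn : n ≤ Module.rank 𝕜 E) :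
    ∃ e : Fin n → E, Orthonormal 𝕜 e := by
  obtain ⟨v, hv⟩ := Module.le_rank_iff.1 hn
  exact ⟨_, InnerProductSpace.gramSchmidtNormed_orthonormal hv⟩

variable {H : Type*} [NormedAddCommGroup H] [InnerProductSpace ℂ H] [CompleteSpace H] {p : ℝ}

lemma IsometricToSubspaceOfLp.exists_linearMap {V : Submodule ℝ (H →L[ℂ] H)}
    (hV : IsometricToSubspaceOfLp p V) :
    ∃ T : V →ₗ[ℝ] RealLp p, ∀ A : V, ‖T A‖ = schattenNorm p (A : H →L[ℂ] H) :=
  let ⟨W, T, hT⟩ := hV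
  ⟨W.subtype ∘ₗ T.toLinearMap, hT⟩

lemma not_exists_isometry_symmetricMatrices {e : Fin 2 → H} (he : Orthonormal ℂ e) (hp : 0 < p)
    (hp2 : p ≠ 2) {α E : Type*} [MeasurableSpace α] (μ : Measure α) [NormedAddCommGroup E]
    [InnerProductSpace ℝ E] :
    ¬ ∃ T : symmetricMatrices e →ₗ[ℝ] Lp E (ENNReal.ofReal p) μ,
      ∀ A : symmetricMatrices e, ‖T A‖ = schattenNorm p (A : H →L[ℂ] H) := by
  rintro ⟨T, hT⟩
  let G : ℝ × ℝ × ℝ →ₗ[ℝ] symmetricMatrices e := (symmetricOp e).codRestrict _ fun v =>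
    range_symmetricOp e ▸ LinearMap.mem_range_self (symmetricOp e) v
  refine not_forall_norm_polar_rpow_eq (F := T ∘ₗ G) hp hp2 fun a r θ => ?_
  rw [LinearMap.comp_apply, hT]
  exact schattenNorm_symmetricOp_polar_rpow he hp a r θ

end Embedding

end Schatten

theorem theorem2_general {H : Type*} [NormedAddCommGroup H] [InnerProductSpace ℂ H]
    [CompleteSpace H] (hH : 2 ≤ Module.rank ℂ H) {p : ℝ} (hp : 0 < p) (hp2 : p ≠ 2)
    {α : Type*} [MeasurableSpace α] (μ : Measure α)
    (E : Type*) [NormedAddCommGroup E] [InnerProductSpace ℝ E] :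
    (∃ V : Submodule ℝ (H →L[ℂ] H),
      (V : Set (H →L[ℂ] H)) ⊆ Schatten.schattenClass H p ∧
      Module.finrank ℝ V = 3 ∧
      ¬ ∃ T : V →ₗ[ℝ] Lp E (ENNReal.ofReal p) μ,
        ∀ A : V, ‖T A‖ = Schatten.schattenNorm p (A : H →L[ℂ] H)) ∧
    (∀ e : Fin 2 → H, Orthonormal ℂ e →
      (Schatten.symmetricMatrices e : Set (H →L[ℂ] H)) ⊆ Schatten.schattenClass H p ∧
      Module.finrank ℝ (Schatten.symmetricMatrices e) = 3 ∧
      ¬ ∃ T : Schatten.symmetricMatrices e →ₗ[ℝ] Lp E (ENNReal.ofReal p) μ,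
        ∀ A : Schatten.symmetricMatrices e, ‖T A‖ = Schatten.schattenNorm p (A : H →L[ℂ] H)) := by
  have hsymm (e : Fin 2 → H) (he : Orthonormal ℂ e) :=
    And.intro (Schatten.symmetricMatrices_subset_schattenClass he hp)
      (And.intro (Schatten.finrank_symmetricMatrices he)
        (Schatten.not_exists_isometry_symmetricMatrices he hp hp2 μ (E := E)))
  obtain ⟨e, he⟩ := Schatten.exists_orthonormal_fin (n := 2) hH
  exact ⟨⟨Schatten.symmetricMatrices e, hsymm e he⟩, hsymm⟩

theorem theorem2 {H : Type*} [NormedAddCommGroup H] [InnerProductSpace ℂ H] [CompleteSpace H]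
    [TopologicalSpace.SeparableSpace H] (hH : 2 ≤ Module.rank ℂ H)
    (p : ℝ) (hp : 1 ≤ p) (hp2 : p ≠ 2) :
    (∃ V : Submodule ℝ (H →L[ℂ] H),
      (V : Set (H →L[ℂ] H)) ⊆ Schatten.schattenClass H p ∧
      Module.finrank ℝ V = 3 ∧
      ¬ Schatten.IsometricToSubspaceOfLp p V) ∧
    (∀ e : Fin 2 → H, Orthonormal ℂ e →
      (Schatten.symmetricMatrices e : Set (H →L[ℂ] H)) ⊆ Schatten.schattenClass H p ∧
      Module.finrank ℝ (Schatten.symmetricMatrices e) = 3 ∧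
      ¬ Schatten.IsometricToSubspaceOfLp p (Schatten.symmetricMatrices e)) := by
  obtain ⟨⟨V, hV, hV3, hVT⟩, h⟩ := theorem2_general hH (zero_lt_one.trans_le hp) hp2
    (volume.restrict (Set.Ioo (0 : ℝ) 1)) ℝ
  exact ⟨⟨V, hV, hV3, mt (·.exists_linearMap) hVT⟩,
    fun e he => (h e he).imp_right (.imp_right (mt (·.exists_linearMap)))⟩
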